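/- Let $X=\{0,1\}$ and let $X^*$ be the rooted binary tree whose vertices are the finite words over $X$, each word $v$ being joined to $v0$ and $v1$; let $\mathrm{Aut}(X^*)$ be its automorphism group. For $g\in\mathrm{Aut}(X^*)$ and $u\in X^*$, the state $g|_u\in\mathrm{Aut}(X^*)$ is defined by $g(uv)=g(u)\,g|_u(v)$ for all $v\in X^*$. A subgroup of $\mathrm{Aut}(X^*)$ is state-closed if it contains all states of its elements, and a representation $G\to\mathrm{Aut}(X^*)$ is state-closed if its image is. An automorphism $g$ is spherically homogeneous if for each $n$ the states of $g$ at all words of length $n$ act identically on the first level $X$ of the tree. Let $G=\mathbb Z_2\wr\mathbb Z=\bigl(\bigoplus_{\mathbb Z}\mathbb Z_2\bigr)\rtimes\mathbb Z$ be the lamplighter group, with $\mathbb Z$ acting on the base group $A=\bigoplus_{\mathbb Z}\mathbb Z_2$ by shifting coordinates. Theorem. For every faithful (that is, injective) state-closed representation $\varphi\colon G\to\mathrm{Aut}(X^*)$ there is a faithful state-closed representation $\psi\colon G\to\mathrm{Aut}(X^*)$ that is conjugate to $\varphi$, i.e. $\psi(g)=c\,\varphi(g)\,c^{-1}$ for all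 $g\in G$ with a fixed $c\in\mathrm{Aut}(X^*)$, and such that $\psi(b)$ is spherically homogeneous for every $b\in A$. -/

import Mathlib

/-- The rooted tree `X*`: its vertices are the finite words over `X`, and `v` is joined to `vx`. -/
def wordTree (X : Type*) : SimpleGraph (List X) where
  Adj u v := (∃ x, v = u ++ [x]) ∨ (∃ x, u = v ++ [x])
  symm := ⟨fun _ _ h => h.symm⟩
  loopless := ⟨fun u h => by
    rcases h with ⟨x, h⟩ | ⟨x, h⟩ <;> simpa using congrArg List.length h⟩

/-- The group of all graph automorphisms of the tree `X*`
(multiplication is composition, `(g * h) v = g (h v)`). -/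
abbrev TreeAut (X : Type*) := wordTree X ≃g wordTree X

namespace TreeAut

variable {X : Type*}

theorem adj_append_iff (u v w : List X) :
    (wordTree X).Adj (u ++ v) (u ++ w) ↔ (wordTree X).Adj v w := by
  simp [wordTree]

/-- Every automorphism of the tree over a finite alphabet fixes the root. -/
theorem map_nil [Finite X] (g : TreeAut X) : g [] = [] := by
  rcases List.eq_nil_or_concat (g []) with h | ⟨w, y, h⟩
  · exact h
  exfalso
  have : Fintype X := Fintype.ofFinite X
  -- every neighbour of `g []` is the image of a one-letter word
  have key : ∀ o : Option X, ∃ x : X,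
      g [x] = (match o with | none => w | some z => g [] ++ [z]) := by
    intro o
    set t : List X := (match o with | none => w | some z => g [] ++ [z]) with ht
    have hadj : (wordTree X).Adj (g []) t := by
      cases o with
      | none => exact Or.inr ⟨y, by simpa [ht] using h⟩
      | some z => exact Or.inl ⟨z, by simp [ht]⟩
    have h2 : (wordTree X).Adj [] (g.symm t) := by
      rw [← g.map_adj_iff]; simpa using hadj
    rcases h2 with ⟨x, hx⟩ | ⟨x, hx⟩
    · exact ⟨x, by rw [← g.apply_symm_apply t, hx]; rfl⟩
    · simp at hx
  choose k hk using key
  have hinj : Function.Injective k := by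
    intro o o' hoo
    have e := hk o
    rw [hoo, hk o'] at e
    cases o <;> cases o' <;> simp only [h] at e
    · rfl
    · simpa using congrArg List.length e
    · simpa using congrArg List.length e
    · simpa using e.symm
  have := Fintype.card_le_of_injective k hinj
  simp at this

theorem exists_map_concat [Finite X] (g : TreeAut X) (v : List X) :
    ∀ x, ∃ y, g (v ++ [x]) = g v ++ [y] := by
  induction v using List.reverseRecOn with
  | nil =>
    intro x
    have h : (wordTree X).Adj (g []) (g ([] ++ [x])) := g.map_adj_iff.2 (Or.inl ⟨x, rfl⟩)
    rcases h with h | ⟨y, hy⟩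
    · exact h
    · rw [map_nil] at hy; simp at hy
  | append_singleton w z ih =>
    intro x
    have h : (wordTree X).Adj (g (w ++ [z])) (g (w ++ [z] ++ [x])) :=
      g.map_adj_iff.2 (Or.inl ⟨x, rfl⟩)
    rcases h with h | ⟨y, hy⟩
    · exact h
    · obtain ⟨z', hz'⟩ := ih z
      rw [hz'] at hy
      have e := g.injective (List.append_inj_left' hy rfl)
      simpa using congrArg List.length e

theorem exists_map_append [Finite X] (g : TreeAut X) (u v : List X) :
    ∃ w, g (u ++ v) = g u ++ w := by
  induction v using List.reverseRecOn with
  | nil => exact ⟨[], by simp⟩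
  | append_singleton v x ih =>
    obtain ⟨w, hw⟩ := ih
    obtain ⟨y, hy⟩ := exists_map_concat g (u ++ v) x
    exact ⟨w ++ [y], by rw [← List.append_assoc, hy, hw, List.append_assoc]⟩

theorem length_map [Finite X] (g : TreeAut X) (v : List X) : (g v).length = v.length := by
  induction v using List.reverseRecOn with
  | nil => rw [map_nil]
  | append_singleton v x ih =>
    obtain ⟨y, hy⟩ := exists_map_concat g v x
    rw [hy]; simp [ih]

theorem map_append_drop [Finite X] (g : TreeAut X) (u v : List X) :
    g u ++ (g (u ++ v)).drop u.length = g (u ++ v) := by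
  obtain ⟨w, hw⟩ := exists_map_append g u v
  rw [hw, ← length_map g u, List.drop_left]

/-- The state (section) `g|_u` of the automorphism `g` at the vertex `u`: the automorphism with
`g (uv) = g(u) g|_u(v)` for all words `v`. -/
def state [Finite X] (g : TreeAut X) (u : List X) : TreeAut X where
  toFun v := (g (u ++ v)).drop u.length
  invFun v := (g.symm (g u ++ v)).drop u.length
  left_inv v := by
    change List.drop _ (g.symm (g u ++ (g (u ++ v)).drop u.length)) = v
    rw [map_append_drop]
    simp
  right_inv v := by
    change List.drop _ (g (u ++ (g.symm (g u ++ v)).drop u.length)) = v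
    have h := map_append_drop (g.symm : TreeAut X) (g u) v
    have e : (g.symm : TreeAut X) (g u) = u := g.symm_apply_apply u
    rw [e, length_map] at h
    rw [h, g.apply_symm_apply, ← length_map g u, List.drop_left]
  map_rel_iff' := by
    intro v w
    change (wordTree X).Adj ((g (u ++ v)).drop u.length) ((g (u ++ w)).drop u.length) ↔ _
    rw [← adj_append_iff (g u), map_append_drop, map_append_drop, g.map_adj_iff, adj_append_iff]

theorem map_append [Finite X] (g : TreeAut X) (u v : List X) :
    g (u ++ v) = g u ++ g.state u v :=
  (map_append_drop g u v).symm

/-- `g` is spherically homogeneous: for each level, its states at all vertices of this level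
act identically on the first level of the tree. -/
def IsSphericallyHomogeneous [Finite X] (g : TreeAut X) : Prop :=
  ∀ u v : List X, u.length = v.length → ∀ x : X, g.state u [x] = g.state v [x]

/-- A group of tree automorphisms is state-closed if it contains all states of its elements. -/
def IsStateClosed [Finite X] (S : Subgroup (TreeAut X)) : Prop :=
  ∀ g ∈ S, ∀ u : List X, g.state u ∈ S

end TreeAut

namespace Lamplighter

/-- The action of `ℤ` on `⨁_ℤ ℤ/2` by translation of the coordinates:
`n` sends the generator at `i` to the generator at `i + n`. -/
noncomputable def shift : Multiplicative ℤ →* MulAut (Multiplicative (ℤ →₀ ZMod 2)) where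
  toFun n := AddEquiv.toMultiplicative (Finsupp.domCongr (Equiv.addRight n.toAdd))
  map_one' := MulEquiv.ext fun f => congrArg Multiplicative.ofAdd <|
    Finsupp.ext fun i => congrArg f.toAdd (show i + -0 = i by simp)
  map_mul' m n := MulEquiv.ext fun f => congrArg Multiplicative.ofAdd <|
    Finsupp.ext fun i => congrArg f.toAdd <|
      show i + -(m.toAdd + n.toAdd) = i + -m.toAdd + -n.toAdd by abel

theorem shift_single (n i : ℤ) (c : ZMod 2) :
    shift (Multiplicative.ofAdd n) (Multiplicative.ofAdd (Finsupp.single i c)) =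
      Multiplicative.ofAdd (Finsupp.single (i + n) c) := by
  simp [shift]

end Lamplighter

/-- The lamplighter group `ℤ/2 ≀ ℤ = (⨁_ℤ ℤ/2) ⋊ ℤ`. -/
abbrev LamplighterGroup := Multiplicative (ℤ →₀ ZMod 2) ⋊[Lamplighter.shift] Multiplicative ℤ

/-- The base group `⨁_ℤ ℤ/2` of the lamplighter group. -/
noncomputable def Lamplighter.base : Subgroup LamplighterGroup :=
  (SemidirectProduct.inl : Multiplicative (ℤ →₀ ZMod 2) →* LamplighterGroup).range

/-! ### Calculus of states -/

namespace TreeAut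

variable {X : Type*}

/-! Elements of the lamplighter group that square to 1 lie in the base group `A`, so a state of `φ
b`, `b ∈ A`, at a fixed vertex again comes from `A` (`mem_base_of_state`). Hence, if `A` fixed the
first level, it would fix the whole tree; so some `a ∈ A` swaps 0 and 1. Take the transversal `r 0 =
1`, `r 1 = a` of the stabilizer of `[0]`. Conjugating by a suitable `twist` makes the state of `g`
at `[x]`, where `g [x] = [y]`, come from the state of `φ (r y⁻¹ g r x)` at `[0]`. This preserves
state-closedness. Since `A` is abelian of exponent 2, for `b ∈ A` the element `r y⁻¹ b r x` is the
same for both letters; so the two first-level states of `ψ b` agree and lie in `ψ A`, and one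
iterates down the levels. -/

theorem state_apply_eq_iff [Finite X] (g : TreeAut X) (u v w : List X) :
    g.state u v = w ↔ g (u ++ v) = g u ++ w := by
  rw [map_append, List.append_cancel_left_eq]

theorem state_one [Finite X] (u : List X) : (1 : TreeAut X).state u = 1 :=
  RelIso.ext fun _ => (state_apply_eq_iff _ _ _ _).2 rfl

theorem state_mul [Finite X] (g h : TreeAut X) (u : List X) :
    (g * h).state u = g.state (h u) * h.state u := by
  refine RelIso.ext fun v => (state_apply_eq_iff _ _ _ _).2 ?_
  rw [RelIso.mul_apply, RelIso.mul_apply, RelIso.mul_apply, map_append h, map_append g]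

theorem state_append [Finite X] (g : TreeAut X) (u v : List X) :
    g.state (u ++ v) = (g.state u).state v := by
  refine RelIso.ext fun w => (state_apply_eq_iff _ _ _ _).2 ?_
  rw [List.append_assoc, map_append, map_append (g.state u), map_append g, List.append_assoc]

theorem state_nil [Finite X] (g : TreeAut X) : g.state [] = g :=
  RelIso.ext fun v => (state_apply_eq_iff _ _ _ _).2 (by simp [map_nil])

theorem exists_map_singleton [Finite X] (g : TreeAut X) (x : X) : ∃ y, g [x] = [y] := by
  simpa [map_nil] using exists_map_concat g [] x

/-- A set of automorphisms that is closed under states at the first level is closed under all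
states. -/
theorem isStateClosed_of_singleton [Finite X] {S : Subgroup (TreeAut X)}
    (h : ∀ g ∈ S, ∀ x : X, g.state [x] ∈ S) : IsStateClosed S := by
  intro g hg u
  induction u generalizing g with
  | nil => rwa [state_nil]
  | cons x u ih =>
    rw [← List.singleton_append, state_append]
    exact ih _ (h g hg x)

/-! ### Automorphisms defined by recursive states -/

theorem adj_cons_cons (x y : X) (u v : List X) :
    (wordTree X).Adj (x :: u) (y :: v) ↔ x = y ∧ (wordTree X).Adj u v := by
  constructor
  · rintro (⟨z, h⟩ | ⟨z, h⟩) <;> simp only [List.cons_append, List.cons.injEq] at h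
    · exact ⟨h.1.symm, Or.inl ⟨z, h.2⟩⟩
    · exact ⟨h.1, Or.inr ⟨z, h.2⟩⟩
  · rintro ⟨rfl, ⟨z, rfl⟩ | ⟨z, rfl⟩⟩
    · exact Or.inl ⟨z, rfl⟩
    · exact Or.inr ⟨z, rfl⟩

theorem adj_nil_cons (y : X) (v : List X) : (wordTree X).Adj [] (y :: v) ↔ v = [] := by
  simp [wordTree]

/-- The map underlying `twist`. -/
def twistFun (t : X → TreeAut X) : List X → List X
  | [] => []
  | x :: w => x :: t x (twistFun t w)

theorem length_twistFun [Finite X] (t : X → TreeAut X) (w : List X) :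
    (twistFun t w).length = w.length := by
  induction w with
  | nil => rfl
  | cons x w ih => simp [twistFun, length_map, ih]

theorem twistFun_bijective [Finite X] (t : X → TreeAut X) : Function.Bijective (twistFun t) := by
  constructor
  · intro u
    induction u with
    | nil =>
      intro v h
      have := congrArg List.length h
      rw [length_twistFun, length_twistFun] at this
      exact (List.eq_nil_of_length_eq_zero this.symm).symm
    | cons x u ih =>
      intro v h
      cases v with
      | nil => simp [twistFun] at h
      | cons y v =>
        simp only [twistFun, List.cons.injEq] at h
        obtain ⟨rfl, h⟩ := h
        rw [ih ((t x).injective h)]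
  · intro w
    -- Induction on length, not on the word: the preimage is needed of `(t x).symm w`, not of the
    -- tail `w`.
    induction n : w.length generalizing w with
    | zero => exact ⟨[], (List.eq_nil_of_length_eq_zero n).symm⟩
    | succ n ih =>
      cases w with
      | nil => simp at n
      | cons x w =>
        obtain ⟨v, hv⟩ := ih ((t x).symm w) (by
          rw [length_map (t x).symm]; simpa using n)
        exact ⟨x :: v, by simp [twistFun, hv]⟩

theorem adj_twistFun [Finite X] (t : X → TreeAut X) (u v : List X) :
    (wordTree X).Adj (twistFun t u) (twistFun t v) ↔ (wordTree X).Adj u v := by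
  have hnil : ∀ y (w : List X),
      (wordTree X).Adj [] (twistFun t (y :: w)) ↔ (wordTree X).Adj [] (y :: w) := by
    intro y w
    rw [twistFun, adj_nil_cons, adj_nil_cons, ← List.length_eq_zero_iff, length_map,
      length_twistFun, List.length_eq_zero_iff]
  induction u generalizing v with
  | nil =>
    cases v with
    | nil => rfl
    | cons y v => exact hnil y v
  | cons x u ih =>
    cases v with
    | nil => rw [SimpleGraph.adj_comm, SimpleGraph.adj_comm _ (x :: u)]; exact hnil x u
    | cons y v =>
      rw [twistFun, twistFun, adj_cons_cons, adj_cons_cons]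
      refine and_congr_right ?_
      rintro rfl
      exact (t x).map_adj_iff.trans (ih v)

/-- The automorphism `c` that fixes the first level and whose states there are `c|_x = t x * c`. -/
noncomputable def twist [Finite X] (t : X → TreeAut X) : TreeAut X where
  toEquiv := Equiv.ofBijective (twistFun t) (twistFun_bijective t)
  map_rel_iff' := adj_twistFun t _ _

theorem twist_singleton [Finite X] (t : X → TreeAut X) (x : X) : twist t [x] = [x] := by
  change x :: t x [] = [x]
  rw [map_nil]

theorem state_twist_singleton [Finite X] (t : X → TreeAut X) (x : X) :
    (twist t).state [x] = t x * twist t :=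
  RelIso.ext fun v => (state_apply_eq_iff _ _ _ _).2 (by rw [twist_singleton]; rfl)

/-- First-level action of the conjugate of an automorphism by `(twist t)⁻¹`. -/
theorem conj_twist_singleton [Finite X] (t : X → TreeAut X) (g : TreeAut X) (x : X) :
    ((twist t)⁻¹ * g * twist t) [x] = g [x] := by
  obtain ⟨y, hy⟩ := exists_map_singleton g x
  rw [RelIso.mul_apply, RelIso.mul_apply, twist_singleton, hy]
  conv_lhs => rw [← twist_singleton t y]
  exact (twist t).symm_apply_apply _

/-- First-level states of the conjugate of an automorphism by `(twist t)⁻¹`. -/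
theorem state_conj_twist_singleton [Finite X] (t : X → TreeAut X) (g : TreeAut X) {x y : X}
    (h : g [x] = [y]) :
    ((twist t)⁻¹ * g * twist t).state [x] =
      (twist t)⁻¹ * ((t y)⁻¹ * g.state [x] * t x) * twist t := by
  have e : (twist t * ((twist t)⁻¹ * g * twist t)).state [x] = (g * twist t).state [x] := by
    congr 1; group
  rw [state_mul (twist t), state_mul g, conj_twist_singleton, h, twist_singleton, state_twist_singleton,
    state_twist_singleton] at e
  rw [← mul_right_inj (t y * twist t), e]
  group

end TreeAut

/-! ### The base group and its action on the first level -/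

namespace Lamplighter

theorem mem_base_iff (g : LamplighterGroup) : g ∈ base ↔ g.right = 1 := by
  rw [base, SemidirectProduct.range_inl_eq_ker_rightHom]; rfl

/-- The base group contains all elements of the lamplighter group of order two. -/
theorem mem_base_of_mul_self {g : LamplighterGroup} (h : g * g = 1) : g ∈ base := by
  rw [mem_base_iff]
  have h' : g.right * g.right = 1 := congrArg SemidirectProduct.right h
  have : g.right.toAdd + g.right.toAdd = 0 := congrArg Multiplicative.toAdd h'
  exact Multiplicative.toAdd.injective (show g.right.toAdd = 0 by lia)

theorem mul_self_of_mem_base {b : LamplighterGroup} (h : b ∈ base) : b * b = 1 := by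
  obtain ⟨f, rfl⟩ := h
  rw [← map_mul, ← map_one SemidirectProduct.inl]
  congr 1
  exact congrArg Multiplicative.ofAdd (Finsupp.ext fun i => CharTwo.add_self_eq_zero (f.toAdd i))

theorem mul_comm_of_mem_base {b c : LamplighterGroup} (hb : b ∈ base) (hc : c ∈ base) :
    b * c = c * b := by
  obtain ⟨f, rfl⟩ := hb
  obtain ⟨g, rfl⟩ := hc
  rw [← map_mul, ← map_mul, mul_comm]

theorem exists_mem_base_ne_one : ∃ b ∈ base, b ≠ 1 := by
  refine ⟨SemidirectProduct.inl (Multiplicative.ofAdd (Finsupp.single 0 1)), ⟨_, rfl⟩, ?_⟩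
  rw [← map_one SemidirectProduct.inl, SemidirectProduct.inl_injective.ne_iff]
  intro h
  exact one_ne_zero (Finsupp.single_eq_zero.1 (congrArg Multiplicative.toAdd h))

open TreeAut

section

variable {X : Type*} [Finite X] {φ : LamplighterGroup →* TreeAut X}

/-- At a fixed vertex taking states is multiplicative, so the state squares to 1 because `b` does;
faithfulness carries this over to `k`. -/
theorem mem_base_of_state (hφ : Function.Injective φ) {b k : LamplighterGroup} (hb : b ∈ base)
    {u : List X} (hu : φ b u = u) (hk : φ k = (φ b).state u) : k ∈ base := by
  refine mem_base_of_mul_self (hφ ?_)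
  have h := state_mul (φ b) (φ b) u
  rw [hu, ← hk, ← map_mul, ← map_mul, mul_self_of_mem_base hb, map_one, state_one] at h
  rw [← h, map_one]

/-- In a faithful state-closed representation the base group acts nontrivially on the first
level. -/
theorem exists_mem_base_map_singleton_ne (hφ : Function.Injective φ)
    (hsc : IsStateClosed φ.range) : ∃ b ∈ base, ∃ x : X, φ b [x] ≠ [x] := by
  by_contra! hfix
  have htriv : ∀ w : List X, ∀ b ∈ base, φ b w = w := by
    intro w
    induction w with
    | nil => exact fun b _ => map_nil _
    | cons x w ih =>
      intro b hb
      obtain ⟨k, hk⟩ := hsc (φ b) ⟨b, rfl⟩ [x]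
      rw [← List.singleton_append, map_append, hfix b hb x, ← hk,
        ih k (mem_base_of_state hφ hb (hfix b hb x) hk)]
  obtain ⟨b, hb, hne⟩ := exists_mem_base_ne_one
  exact hne (hφ (by rw [map_one]; exact RelIso.ext fun w => htriv w b hb))

end

theorem singleton_eq_one_of_ne {y : Fin 2} (h : [y] ≠ [0]) : y = 1 := by
  by_contra h1
  exact h (by congr 1; lia)

theorem map_one_of_map_zero (g : TreeAut (Fin 2)) (h : g [0] = [0]) : g [1] = [1] := by
  obtain ⟨y, hy⟩ := exists_map_singleton g 1
  have : y ≠ 0 := by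
    rintro rfl
    simpa using g.injective (hy.trans h.symm)
  rw [hy, singleton_eq_one_of_ne (y := y) (by simpa using this)]

theorem map_one_of_map_zero_eq_one (g : TreeAut (Fin 2)) (h : g [0] = [1]) : g [1] = [0] := by
  obtain ⟨y, hy⟩ := exists_map_singleton g 1
  have : y ≠ 1 := by
    rintro rfl
    simpa using g.injective (hy.trans h.symm)
  rw [hy]; congr 1; lia

end Lamplighter

open TreeAut Lamplighter in
/-- Every faithful state-closed representation `φ` of the lamplighter group `ℤ/2 ≀ ℤ` on the binary
tree is conjugate, in the automorphism group of the tree, to a faithful state-closed representation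
`ψ` that maps the base group into the spherically homogeneous automorphisms. -/
theorem mainTheorem3 (φ : LamplighterGroup →* TreeAut (Fin 2)) (hφ : Function.Injective φ)
    (hsc : TreeAut.IsStateClosed φ.range) :
    ∃ ψ : LamplighterGroup →* TreeAut (Fin 2),
      Function.Injective ψ ∧ TreeAut.IsStateClosed ψ.range ∧
      (∃ c : TreeAut (Fin 2), ∀ g : LamplighterGroup, ψ g = c * φ g * c⁻¹) ∧
      ∀ b ∈ Lamplighter.base, TreeAut.IsSphericallyHomogeneous (ψ b) := by
  obtain ⟨a, ha, z, hz⟩ := exists_mem_base_map_singleton_ne hφ hsc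
  have ha0 : φ a [0] = [1] := by
    obtain ⟨y, hy⟩ := exists_map_singleton (φ a) 0
    have : [y] ≠ [0] := by
      intro h
      have h0 := hy.trans h
      have h1 := map_one_of_map_zero _ h0
      fin_cases z
      · exact hz h0
      · exact hz h1
    rw [hy, singleton_eq_one_of_ne this]
  -- a transversal of the stabilizer of `[0]` inside the base group
  obtain ⟨r, hr0, hr1, hrmap⟩ : ∃ r : Fin 2 → LamplighterGroup,
      r 0 = 1 ∧ r 1 = a ∧ ∀ x, φ (r x) [0] = [x] := by
    refine ⟨![1, a], rfl, rfl, fun x => ?_⟩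
    fin_cases x
    · simp
    · exact ha0
  -- State-closedness puts the states of the transversal in the image of `φ`, so conjugating by the
  -- twist they define keeps states inside the image.
  choose h hh using fun x => hsc (φ (r x)) ⟨r x, rfl⟩ [0]
  set c : TreeAut (Fin 2) := (twist fun x => φ (h x))⁻¹ with hc
  let ψ : LamplighterGroup →* TreeAut (Fin 2) := (MulAut.conj c).toMonoidHom.comp φ
  have hψ : ∀ g, ψ g = c * φ g * c⁻¹ := fun g => rfl
  have hstate : ∀ g k x y, φ g [x] = [y] → φ k = (φ ((r y)⁻¹ * g * r x)).state [0] →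
      (ψ g).state [x] = ψ k := by
    intro g k x y hxy hk
    -- Compare states at `[x]` in `g = r y * ((r y)⁻¹ * g)`, whose second factor sends `[x]` to
    -- `[0]`.
    have hr : (φ ((r y)⁻¹ * g)).state [x] = (φ (h y))⁻¹ * (φ g).state [x] := by
      have hx0 : φ ((r y)⁻¹ * g) [x] = [0] := by
        rw [map_mul, RelIso.mul_apply, hxy, ← hrmap y, ← RelIso.mul_apply, ← map_mul]
        simp
      have e := state_mul (φ (r y)) (φ ((r y)⁻¹ * g)) [x]
      rw [← map_mul, mul_inv_cancel_left, hx0, ← hh] at e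
      rw [e]; group
    have hk' : φ k = (φ (h y))⁻¹ * (φ g).state [x] * φ (h x) := by
      rw [hk, map_mul, state_mul, hrmap, ← hh x, hr]
    rw [hψ, hψ, hc, inv_inv, state_conj_twist_singleton _ _ hxy, hk']
  have hbase : ∀ b ∈ base, ∃ b' ∈ base, ∀ x, (ψ b).state [x] = ψ b' := by
    intro b hb
    obtain ⟨y, hy⟩ := exists_map_singleton (φ b) 0
    have hrmem : ∀ x, r x ∈ base := by
      intro x
      fin_cases x
      · exact hr0 ▸ one_mem _
      · exact hr1 ▸ ha
    have hmem : (r y)⁻¹ * b ∈ base := mul_mem (inv_mem (hrmem y)) hb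
    have hfix : φ ((r y)⁻¹ * b) [0] = [0] := by
      rw [map_mul, RelIso.mul_apply, hy, ← hrmap y, ← RelIso.mul_apply, ← map_mul]
      simp
    obtain ⟨k, hk⟩ := hsc (φ ((r y)⁻¹ * b)) ⟨_, rfl⟩ [0]
    refine ⟨k, mem_base_of_state hφ hmem hfix hk, fun x => ?_⟩
    have haa := mul_self_of_mem_base ha
    have hab := mul_comm_of_mem_base ha hb
    have hinv : a⁻¹ = a := inv_eq_of_mul_eq_one_left haa
    -- The same `k` serves both letters: `a⁻¹ b a = b` if `b` fixes the level, and `a⁻¹ b = b a` if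
    -- it swaps it.
    by_cases hy0 : y = 0
    · subst hy0
      fin_cases x
      · exact hstate _ _ 0 0 hy (by rw [hk, hr0, mul_one])
      · refine hstate _ _ 1 1 (map_one_of_map_zero _ hy) ?_
        rw [hk, hr0, hr1, mul_assoc, ← hab, inv_mul_cancel_left, inv_one, one_mul]
    · obtain rfl : y = 1 := by lia
      fin_cases x
      · exact hstate _ _ 0 1 hy (by rw [hk, hr0, mul_one])
      · refine hstate _ _ 1 0 (map_one_of_map_zero_eq_one _ hy) ?_
        rw [hk, hr0, hr1, inv_one, one_mul, hinv, hab]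
  refine ⟨ψ, (MulAut.conj c).injective.comp hφ, ?_, ⟨c, hψ⟩, ?_⟩
  · refine isStateClosed_of_singleton ?_
    rintro _ ⟨g, rfl⟩ x
    obtain ⟨y, hy⟩ := exists_map_singleton (φ g) x
    obtain ⟨k, hk⟩ := hsc (φ ((r y)⁻¹ * g * r x)) ⟨_, rfl⟩ [0]
    exact ⟨k, (hstate g k x y hy hk).symm⟩
  · intro b hb
    have key : ∀ n, ∀ b ∈ base, ∃ b' ∈ base, ∀ u : List (Fin 2), u.length = n →
        (ψ b).state u = ψ b' := by
      intro n
      induction n with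
      | zero =>
        refine fun b hb => ⟨b, hb, fun u hu => ?_⟩
        rw [List.eq_nil_of_length_eq_zero hu, state_nil]
      | succ n ih =>
        intro b hb
        obtain ⟨b₁, hb₁, h₁⟩ := hbase b hb
        obtain ⟨b₂, hb₂, h₂⟩ := ih b₁ hb₁
        refine ⟨b₂, hb₂, fun u hu => ?_⟩
        cases u with
        | nil => simp at hu
        | cons x u =>
          rw [← List.singleton_append, state_append, h₁, h₂ u (by simpa using hu)]
    intro u v huv x
    obtain ⟨b', -, hb'⟩ := key u.length b hb
    rw [hb' u rfl, hb' v huv.symm]
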